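/- For a lower semicontinuous function $h:\mathbb R\to[0,\infty)$ put $\Omega_h:=\{(x,y)\in\mathbb R^2:\ 0<y<h(x)\}$, and let $$\int_{\mathbb R}|h'|:=\sup\Big\{\sum_{i=1}^n|h(x_i)-h(x_{i-1})|:\ n\in\mathbb N,\ x_0<x_1<\dots<x_n\Big\}\in[0,\infty]$$ denote its pointwise variation. For $V>0$ let $\mathcal A^\ell_V$ be the set of all pairs $(u,h)$ such that $h\in BV(\mathbb R)$ is lower semicontinuous with $h\ge 0$ and $\int_{\mathbb R}h\,dx=V$, and $u\in H^1(\Omega_h)$ satisfies $u(x,0)=x$, in the sense of traces, on the part $\{(x,0):\ h(x)>0\}$ of the boundary of $\Omega_h$. Set $$F_\ell(V):=\inf\Big\{\int_{\Omega_h}|\nabla u|^2\,dx\,dy+\int_{\mathbb R}|h'|\ :\ (u,h)\in\mathcal A^\ell_V\Big\}.$$ **Proposition.** For every $\delta>0$ there is $\widetilde V(\delta)>0$ such that for every $0<V<\widetilde V(\delta)$, $$(1-\delta)V\le F_\ell(V)\le V.$$ In particular, $\displaystyle\lim_{V\to0^+}\frac{F_\ell(V)}{V}=1$. -/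

import Mathlib

open MeasureTheory Filter Topology
open scoped ENNReal

noncomputable section

namespace EpitaxialFilm

/-- The domain occupied by the film: the strict subgraph `{(x, y) : 0 < y < h x}`. -/
def filmDomain (h : ℝ → ℝ) : Set (ℝ × ℝ) := {p | 0 < p.2 ∧ p.2 < h p.1}

/-- The part of the substrate line `{y = 0}` that is covered by film. -/
def filmBase (h : ℝ → ℝ) : Set (ℝ × ℝ) := {p | p.2 = 0 ∧ 0 < h p.1}

/-- `h ∈ BV(ℝ)`: `h` is integrable and its distributional derivative has finite total variation. -/
def MemBV (h : ℝ → ℝ) : Prop :=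
  Integrable h ∧
    ∃ C : ℝ, ∀ φ : ℝ → ℝ, ContDiff ℝ 1 φ → HasCompactSupport φ → (∀ x, |φ x| ≤ 1) →
      ∫ x, h x * deriv φ x ≤ C

/-- The vector field `g` is the weak (distributional) gradient of `u` in the open set `Ω ⊆ ℝ²`. -/
def IsWeakGradient (Ω : Set (ℝ × ℝ)) (u : ℝ × ℝ → ℝ) (g : ℝ × ℝ → ℝ × ℝ) : Prop :=
  ∀ φ : ℝ × ℝ → ℝ, ContDiff ℝ ((⊤ : ℕ∞) : WithTop ℕ∞) φ → HasCompactSupport φ →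
    tsupport φ ⊆ Ω →
      (∫ p in Ω, u p * fderiv ℝ φ p (1, 0) = -∫ p in Ω, (g p).1 * φ p) ∧
      (∫ p in Ω, u p * fderiv ℝ φ p (0, 1) = -∫ p in Ω, (g p).2 * φ p)

/-- `u ∈ H¹(Ω)` with weak gradient `g`. -/
structure IsSobolevWithGradient (Ω : Set (ℝ × ℝ)) (u : ℝ × ℝ → ℝ) (g : ℝ × ℝ → ℝ × ℝ) :
    Prop where
  memLp : MemLp u 2 (volume.restrict Ω)
  memLp_gradient : MemLp g 2 (volume.restrict Ω)
  isWeakGradient : IsWeakGradient Ω u g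

/-- For `u ∈ H¹` of the film domain with weak gradient `g`: the trace of `u` on the base of the film
is `w`, i.e. `u(x, 0) = w x` for a.e. `x` with `h x > 0`. The trace is characterised by Green's
formula (the outer normal on the base is `(0, -1)`), tested with smooth functions that may be
nonzero on the base but vanish near the rest of the boundary of the film domain. -/
def HasBaseTrace (h : ℝ → ℝ) (u : ℝ × ℝ → ℝ) (g : ℝ × ℝ → ℝ × ℝ) (w : ℝ → ℝ) : Prop :=
  ∀ φ : ℝ × ℝ → ℝ, ContDiff ℝ ((⊤ : ℕ∞) : WithTop ℕ∞) φ → HasCompactSupport φ →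
    tsupport φ ∩ {p | 0 ≤ p.2} ⊆ filmDomain h ∪ filmBase h →
      (∫ p in filmDomain h, u p * fderiv ℝ φ p (0, 1)) +
          ∫ p in filmDomain h, (g p).2 * φ p =
        -∫ x in {x | 0 < h x}, w x * φ (x, 0)

/-- The configuration with profile `h` and displacement `u` is admissible for the volume `V` in the
large slope model; `g` is the weak gradient of `u` (unique a.e. in the film domain). -/
structure IsAdmissible (V : ℝ) (h : ℝ → ℝ) (u : ℝ × ℝ → ℝ) (g : ℝ × ℝ → ℝ × ℝ) : Prop where
  memBV : MemBV h
  lowerSemicontinuous : LowerSemicontinuous h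
  nonneg : ∀ x, 0 ≤ h x
  volume_eq : ∫ x, h x = V
  sobolev : IsSobolevWithGradient (filmDomain h) u g
  trace : HasBaseTrace h u g (fun x => x)

/-- The elastic energy `∫_{Ω_h} |∇u|²`, with `g = ∇u`. -/
def elasticEnergy (h : ℝ → ℝ) (g : ℝ × ℝ → ℝ × ℝ) : ℝ≥0∞ :=
  ∫⁻ p in filmDomain h, ENNReal.ofReal ((g p).1 ^ 2 + (g p).2 ^ 2)

/-- The surface energy `∫ |h'|`: the pointwise variation of `h` on `ℝ`. -/
def surfaceEnergy (h : ℝ → ℝ) : ℝ≥0∞ := eVariationOn h Set.univ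

/-- The minimal energy `F_ℓ(V)` of the large slope model. -/
def minEnergy (V : ℝ) : ℝ≥0∞ :=
  ⨅ (h : ℝ → ℝ) (u : ℝ × ℝ → ℝ) (g : ℝ × ℝ → ℝ × ℝ) (_ : IsAdmissible V h u g),
    elasticEnergy h g + surfaceEnergy h

end EpitaxialFilm

end

/-! For small V the infimum equals V exactly, which is more than the estimate with δ. Upper bound: a
flat film of small height H and length V/H with u(x,y) = x costs V + 2H at most; let H → 0. Lower
bound, by duality. Let W be the variation of h; if W > V nothing is left to show. If h were smooth,
the field (1, h') would be divergence-free and tangent to the graph of h, so its pairing with ∇u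
would see only the trace x on the base and equal ∫ h = V. Young's inequality then gives ∫|∇u|² ≥ V -
(sup |h'|)² V. A general h is replaced by a smooth minorant k with ∫ k ≥ V - W/2 and |k'| ≤ CW
(`exists_smooth_minorant`). The field comes from a regularised stream function
(`integral_gradient_mul_stream`, `two_mul_integral_comp_le`), whence ∫|∇u|² ≥ V - W/2 - C²W²V
(`integral_minorant_le_energy`). As W ≤ V, the last term is at most W/2 for small V, so the surface
energy W pays for both losses. -/

namespace EpitaxialFilm

/-! ### Bounded variation and smooth minorants -/

/-- A function of bounded variation has a bounded monotone function that dominates its increments. -/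
theorem exists_monotone_dominating_increments {h : ℝ → ℝ} (hv : BoundedVariationOn h Set.univ) :
    ∃ T : ℝ → ℝ, Monotone T ∧ (∀ x, 0 ≤ T x) ∧
      (∀ x, T x ≤ (eVariationOn h Set.univ).toReal) ∧
      ∀ a b, a ≤ b → |h b - h a| ≤ T b - T a := by
  have hfin : ∀ s : Set ℝ, eVariationOn h s ≠ ⊤ := fun s =>
    ne_top_of_le_ne_top hv (eVariationOn.mono h (Set.subset_univ s))
  refine ⟨fun x => (eVariationOn h (Set.Iic x)).toReal, ?_, fun x => ENNReal.toReal_nonneg,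
    fun x => ENNReal.toReal_mono hv (eVariationOn.mono h (Set.subset_univ _)), ?_⟩
  · intro a b hab
    exact ENNReal.toReal_mono (hfin _) (eVariationOn.mono h (Set.Iic_subset_Iic.2 hab))
  · intro a b hab
    have h1 : eVariationOn h (Set.Iic a) + eVariationOn h {a, b} ≤ eVariationOn h (Set.Iic b) := by
      refine (eVariationOn.add_le_union h ?_).trans (eVariationOn.mono h ?_)
      · rintro x hx y (rfl | rfl)
        · exact hx
        · exact le_trans hx hab
      · rintro x (hx | rfl | rfl)
        · exact le_trans hx hab
        · exact hab
        · exact Set.mem_Iic.2 le_rfl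
    have h2 := ENNReal.toReal_mono (hfin _) h1
    rw [ENNReal.toReal_add (hfin _) (hfin _), eVariationOn.pair, edist_dist,
      ENNReal.toReal_ofReal dist_nonneg, dist_comm, Real.dist_eq] at h2
    linarith

/-- The integral over [-R, R] telescopes: what remains is the integral of T over an interval of
length 2r around R minus the one around -R. The bound does not depend on R, which also yields
integrability. -/
theorem integral_sub_shift_le {T : ℝ → ℝ} (hT : Monotone T) {W r : ℝ} (hr : 0 ≤ r)
    (h0 : ∀ x, 0 ≤ T x) (hW : ∀ x, T x ≤ W) :
    Integrable (fun x => T (x + r) - T (x - r)) ∧ ∫ x, T (x + r) - T (x - r) ≤ 2 * r * W := by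
  have hi : ∀ a b, IntervalIntegrable T volume a b := fun a b => hT.intervalIntegrable
  have hm : ∀ c, Monotone fun x => T (x + c) := fun c x y hxy => hT (by linarith)
  have hii : ∀ c a b, IntervalIntegrable (fun x => T (x + c)) volume a b :=
    fun c a b => (hm c).intervalIntegrable
  have hii' : ∀ c a b, IntervalIntegrable (fun x => T (x - c)) volume a b :=
    fun c a b => by simpa [sub_eq_add_neg] using hii (-c) a b
  have key : ∀ R : ℝ, ∫ x in (-R)..R, (T (x + r) - T (x - r)) ≤ 2 * r * W := by
    intro R
    rw [intervalIntegral.integral_sub (hii r _ _) (hii' r _ _),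
      intervalIntegral.integral_comp_add_right (fun x => T x),
      intervalIntegral.integral_comp_sub_right (fun x => T x)]
    have e1 : (∫ x in (-R + r)..(R + r), T x) =
        (∫ x in (-R + r)..(R - r), T x) + ∫ x in (R - r)..(R + r), T x :=
      (intervalIntegral.integral_add_adjacent_intervals (hi _ _) (hi _ _)).symm
    have e2 : (∫ x in (-R - r)..(R - r), T x) =
        (∫ x in (-R - r)..(-R + r), T x) + ∫ x in (-R + r)..(R - r), T x :=
      (intervalIntegral.integral_add_adjacent_intervals (hi _ _) (hi _ _)).symm
    have e3 : (∫ x in (R - r)..(R + r), T x) ≤ ∫ x in (R - r)..(R + r), W :=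
      intervalIntegral.integral_mono (by linarith) (hi _ _) (by simp) fun x => hW x
    have e4 : 0 ≤ ∫ x in (-R - r)..(-R + r), T x :=
      intervalIntegral.integral_nonneg (by linarith) fun x _ => h0 x
    rw [intervalIntegral.integral_const, smul_eq_mul] at e3
    rw [e1, e2]
    linarith
  have hD : ∀ x, 0 ≤ T (x + r) - T (x - r) := fun x => sub_nonneg.2 (hT (by linarith))
  have hint : Integrable (fun x => T (x + r) - T (x - r)) := by
    refine integrable_of_intervalIntegral_norm_bounded (2 * r * W) (a := fun n : ℕ => -(n : ℝ))
      (b := fun n : ℕ => (n : ℝ)) (l := atTop) ?_ ?_ tendsto_natCast_atTop_atTop ?_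
    · intro n
      exact ((hii r _ _).sub (hii' r _ _)).1
    · exact tendsto_neg_atTop_atBot.comp tendsto_natCast_atTop_atTop
    · refine Eventually.of_forall fun n => ?_
      simpa only [Real.norm_of_nonneg (hD _)] using key n
  refine ⟨hint, ?_⟩
  exact le_of_tendsto (intervalIntegral_tendsto_integral hint
    (tendsto_neg_atTop_atBot.comp tendsto_natCast_atTop_atTop)
    (tendsto_natCast_atTop_atTop (R := ℝ))) (Eventually.of_forall fun n => key n)

/-- Bounded variation gives limits at both ends; a nonzero limit would contradict integrability on a
half-line of infinite measure. -/
theorem tendsto_zero_of_integrable_of_boundedVariationOn {h : ℝ → ℝ} (hi : Integrable h)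
    (hv : BoundedVariationOn h Set.univ) :
    Tendsto h atTop (𝓝 0) ∧ Tendsto h atBot (𝓝 0) := by
  constructor
  · obtain ⟨l, hl⟩ := hv.exists_tendsto_atTop
    rw [principal_univ, top_inf_eq] at hl
    have : l = 0 := IntegrableAtFilter.eq_zero_of_tendsto (hi.integrableAtFilter atTop)
      (fun s hs => by
        obtain ⟨a, ha⟩ := mem_atTop_sets.1 hs
        exact top_unique (Real.volume_Ici (a := a) ▸ measure_mono ha)) hl
    exact this ▸ hl
  · obtain ⟨l, hl⟩ := hv.exists_tendsto_atBot
    rw [principal_univ, top_inf_eq] at hl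
    have : l = 0 := IntegrableAtFilter.eq_zero_of_tendsto (hi.integrableAtFilter atBot)
      (fun s hs => by
        obtain ⟨a, ha⟩ := mem_atBot_sets.1 hs
        exact top_unique (Real.volume_Iic (a := a) ▸ measure_mono ha)) hl
    exact this ▸ hl

theorem abs_le_eVariationOn_of_tendsto_zero {h : ℝ → ℝ} (hv : BoundedVariationOn h Set.univ)
    (h0 : Tendsto h atTop (𝓝 0)) (x : ℝ) : |h x| ≤ (eVariationOn h Set.univ).toReal := by
  have h1 : Tendsto (fun y => |h x - h y|) atTop (𝓝 |h x - 0|) := (tendsto_const_nhds.sub h0).abs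
  rw [sub_zero] at h1
  refine le_of_tendsto h1 (Eventually.of_forall fun y => ?_)
  simpa [Real.dist_eq] using hv.dist_le (Set.mem_univ x) (Set.mem_univ y)

/-- A function of bounded variation can be approximated from below by smooth functions: the loss of
mass is at most half of the variation, and the slope is controlled by the variation. -/
theorem exists_smooth_minorant : ∃ C : ℝ, 0 ≤ C ∧ ∀ h : ℝ → ℝ, Integrable h →
    BoundedVariationOn h Set.univ → ∃ k : ℝ → ℝ, ContDiff ℝ ((⊤ : ℕ∞) : WithTop ℕ∞) k ∧
      (∀ x, k x ≤ h x) ∧ Integrable k ∧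
      (∫ x, h x) - (eVariationOn h Set.univ).toReal / 2 ≤ ∫ x, k x ∧
      ∀ x, |deriv k x| ≤ C * (eVariationOn h Set.univ).toReal := by
  let ρ₀ : ContDiffBump (0 : ℝ) := ⟨1 / 8, 1 / 4, by norm_num, by norm_num⟩
  let ρ : ℝ → ℝ := ρ₀.normed volume
  have hρs : ContDiff ℝ ((⊤ : ℕ∞) : WithTop ℕ∞) ρ := ρ₀.contDiff_normed
  have hρc : HasCompactSupport ρ := ρ₀.hasCompactSupport_normed
  have hρi : Integrable ρ := hρs.continuous.integrable_of_hasCompactSupport hρc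
  have hρ1 : ∫ x, ρ x = 1 := ρ₀.integral_normed
  have hρ0 : ∀ x, 0 ≤ ρ x := fun x => ρ₀.nonneg_normed x
  have hρ4 : ∀ x, ρ x ≠ 0 → |x| < 1 / 4 := fun x hx => by
    have : x ∈ Function.support (ρ₀.normed volume) := hx
    rw [ρ₀.support_normed_eq] at this
    simpa [ρ₀] using this
  have hρdi : Integrable (deriv ρ) :=
    (hρs.continuous_deriv (by simp)).integrable_of_hasCompactSupport hρc.deriv
  -- The minorant is m ∗ ρ with |m| ≤ 2W, so its derivative m ∗ ρ' is at most 2W ∫|ρ'|.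
  refine ⟨2 * ∫ x, |deriv ρ x|, mul_nonneg zero_le_two (integral_nonneg fun x => abs_nonneg _),
    fun h hi hv => ?_⟩
  obtain ⟨T, hTm, hT0, hTW, hT⟩ := exists_monotone_dominating_increments hv
  set W := (eVariationOn h Set.univ).toReal with hW
  -- The window 1/4 matches the radius of the mollifier and makes the lost mass ∫ D at most 2 ·
  -- (1/4) · W = W/2, strictly less than the surface energy when W > 0.
  obtain ⟨hDi, hDW⟩ := integral_sub_shift_le hTm (r := 1 / 4) (by norm_num) hT0 hTW
  set D : ℝ → ℝ := fun x => T (x + 1 / 4) - T (x - 1 / 4) with hD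
  let m : ℝ → ℝ := fun x => h x - D x
  have hmi : Integrable m := hi.sub hDi
  let L := ContinuousLinearMap.mul ℝ ℝ
  have hk : ∀ (g : ℝ → ℝ) (x : ℝ), convolution m g L volume x = ∫ t, m (x - t) * g t := by
    intro g x
    rw [convolution_eq_swap]
    rfl
  have hhW := abs_le_eVariationOn_of_tendsto_zero hv
    (tendsto_zero_of_integrable_of_boundedVariationOn hi hv).1
  -- D(x - t) dominates the change of h between x - t and any point within 1/4 of it, in particular
  -- x. Hence every value averaged by the mollifier at x lies below h(x).
  have hclose : ∀ x t, |t| < 1 / 4 → m (x - t) ≤ h x := by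
    intro x t ht
    rw [abs_lt] at ht
    have h1 : h (x - t) - h x ≤ D (x - t) := by
      rcases le_total 0 t with h0 | h0
      · have := hT (x - t) x (by linarith)
        have h2 := hTm (show x ≤ x - t + 1 / 4 by linarith)
        have h3 := hTm (show x - t - 1 / 4 ≤ x - t by linarith)
        have h4 := neg_abs_le (h x - h (x - t))
        simp only [hD]
        linarith
      · have := hT x (x - t) (by linarith)
        have h2 := hTm (show x - t ≤ x - t + 1 / 4 by linarith)
        have h3 := hTm (show x - t - 1 / 4 ≤ x by linarith)
        have h4 := le_abs_self (h (x - t) - h x)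
        simp only [hD]
        linarith
    simp only [m]
    linarith
  have hLm : ∀ g : ℝ → ℝ, Continuous g → HasCompactSupport g → ∀ x,
      Integrable fun t => m (x - t) * g t := by
    intro g hg hgc x
    have := (hgc.convolutionExists_right L hmi.locallyIntegrable hg x).integrable_swap
    exact this
  have hmW : ∀ x, |m x| ≤ 2 * W := by
    intro x
    have h1 := hTW (x + 1 / 4)
    have h2 := hT0 (x - 1 / 4)
    have h3 := hTm (show x - 1 / 4 ≤ x + 1 / 4 by linarith)
    have h4 := abs_le.1 (hhW x)
    simp only [m, hD, abs_le]
    constructor <;> linarith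
  refine ⟨convolution m ρ L volume, hρc.contDiff_convolution_right L hmi.locallyIntegrable hρs,
    ?_, hmi.integrable_convolution L hρi, ?_, ?_⟩
  · intro x
    rw [hk]
    calc ∫ t, m (x - t) * ρ t ≤ ∫ t, h x * ρ t := by
          refine integral_mono (hLm ρ hρs.continuous hρc x) (hρi.const_mul _) fun t => ?_
          by_cases ht : ρ t = 0
          · simp [ht]
          · exact mul_le_mul_of_nonneg_right (hclose x t (hρ4 t ht)) (hρ0 t)
      _ = h x := by rw [integral_const_mul, hρ1, mul_one]
  · rw [integral_convolution L hmi hρi, hρ1]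
    have : ∫ x, m x = (∫ x, h x) - ∫ x, D x := integral_sub hi hDi
    simp only [L, ContinuousLinearMap.mul_apply', this, mul_one]
    linarith
  · intro x
    rw [(hρc.hasDerivAt_convolution_right L hmi.locallyIntegrable (hρs.of_le (by simp)) x).deriv, hk]
    calc |∫ t, m (x - t) * deriv ρ t| ≤ ∫ t, |m (x - t) * deriv ρ t| := abs_integral_le_integral_abs
      _ ≤ ∫ t, |deriv ρ t| * (2 * W) := by
          refine integral_mono (hLm _ (hρs.continuous_deriv (by simp)) hρc.deriv x).abs
            (hρdi.abs.mul_const _) fun t => ?_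
          simp only [abs_mul]
          rw [mul_comm]
          exact mul_le_mul_of_nonneg_left (hmW _) (abs_nonneg _)
      _ = _ := by rw [integral_mul_const]; ring

/-! ### Green's formula and stream functions -/

theorem filmDomain_eq_regionBetween (h : ℝ → ℝ) :
    filmDomain h = regionBetween (fun _ => 0) h Set.univ := by
  ext p
  simp [filmDomain, regionBetween]

theorem measurableSet_filmDomain {h : ℝ → ℝ} (hm : Measurable h) :
    MeasurableSet (filmDomain h) := by
  rw [filmDomain_eq_regionBetween]
  exact measurableSet_regionBetween measurable_const hm MeasurableSet.univ

theorem volume_filmDomain {h : ℝ → ℝ} (hm : Measurable h) :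
    volume (filmDomain h) = ∫⁻ x, ENNReal.ofReal (h x) := by
  rw [filmDomain_eq_regionBetween, Measure.volume_eq_prod,
    volume_regionBetween_eq_lintegral measurable_const.aemeasurable hm.aemeasurable
      MeasurableSet.univ]
  simp

theorem isFiniteMeasure_restrict_filmDomain {h : ℝ → ℝ} (hm : Measurable h) (hi : Integrable h) :
    IsFiniteMeasure (volume.restrict (filmDomain h)) := by
  refine ⟨?_⟩
  rw [Measure.restrict_apply_univ, volume_filmDomain hm]
  refine lt_of_le_of_lt (lintegral_mono fun x => ?_) hi.2
  rw [← ofReal_norm]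
  exact ENNReal.ofReal_le_ofReal (le_abs_self _)

theorem integrable_mul_of_hasCompactSupport {X : Type*} [TopologicalSpace X] [MeasurableSpace X]
    [OpensMeasurableSpace X] {μ : Measure X} {u φ : X → ℝ} (hu : Integrable u μ)
    (hφ : Continuous φ) (hc : HasCompactSupport φ) : Integrable (fun p => u p * φ p) μ := by
  obtain ⟨C, hC⟩ := hc.exists_bound_of_continuous hφ
  exact hu.mul_bdd hφ.aestronglyMeasurable (Eventually.of_forall hC)

theorem contDiff_fderiv_apply {E : Type*} [NormedAddCommGroup E] [NormedSpace ℝ E] {ψ : E → ℝ}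
    (hψ : ContDiff ℝ ((⊤ : ℕ∞) : WithTop ℕ∞) ψ) (v : E) :
    ContDiff ℝ ((⊤ : ℕ∞) : WithTop ℕ∞) fun p => fderiv ℝ ψ p v :=
  (hψ.fderiv_right (by simp)).clm_apply contDiff_const

theorem tsupport_fderiv_apply_subset {E : Type*} [NormedAddCommGroup E] [NormedSpace ℝ E]
    (ψ : E → ℝ) (v : E) : tsupport (fun p => fderiv ℝ ψ p v) ⊆ tsupport ψ := by
  refine (closure_mono fun p hp => ?_).trans (tsupport_fderiv_subset ℝ (f := ψ))
  intro h0
  exact hp (by simp [h0])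

/-- The horizontal part of Green's formula in the film domain: the base does not contribute, since
its normal is vertical. -/
theorem integral_mul_fderiv_horizontal {h : ℝ → ℝ} (hm : Measurable h) (hi : Integrable h)
    {u : ℝ × ℝ → ℝ} {g : ℝ × ℝ → ℝ × ℝ} (hs : IsSobolevWithGradient (filmDomain h) u g)
    {φ : ℝ × ℝ → ℝ} (hφ : ContDiff ℝ ((⊤ : ℕ∞) : WithTop ℕ∞) φ) (hc : HasCompactSupport φ)
    (hsupp : tsupport φ ∩ {p | 0 ≤ p.2} ⊆ filmDomain h ∪ filmBase h) :
    ∫ p in filmDomain h, u p * fderiv ℝ φ p (1, 0) = -∫ p in filmDomain h, (g p).1 * φ p := by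
  have := isFiniteMeasure_restrict_filmDomain hm hi
  have hΩ := measurableSet_filmDomain hm
  have hu : Integrable u (volume.restrict (filmDomain h)) := hs.memLp.integrable (by norm_num)
  have hg : Integrable (fun p => (g p).1) (volume.restrict (filmDomain h)) :=
    (hs.memLp_gradient.integrable (by norm_num)).fst
  -- The weak gradient can only be tested inside the open film, so the test function is cut off near
  -- the base: for n ≥ 1, `σ n` is 0 for y ≤ 1/n and 1 for y ≥ 2/n. Depending on y alone, the cutoff
  -- contributes nothing to the horizontal derivative.
  let σ : ℕ → ℝ → ℝ := fun n y => Real.smoothTransition (n * y - 1)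
  have hσs : ∀ n, ContDiff ℝ ((⊤ : ℕ∞) : WithTop ℕ∞) (σ n) := fun n =>
    Real.smoothTransition.contDiff.comp ((contDiff_const.mul contDiff_id).sub contDiff_const)
  have hσ1 : ∀ n y, ‖σ n y‖ ≤ 1 := fun n y => by
    rw [Real.norm_of_nonneg (Real.smoothTransition.nonneg _)]
    exact Real.smoothTransition.le_one _
  have hσlim : ∀ y, 0 < y → Tendsto (fun n => σ n y) atTop (𝓝 1) := by
    intro y hy
    refine tendsto_const_nhds.congr' ?_
    have : Tendsto (fun n : ℕ => (n : ℝ) * y) atTop atTop :=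
      tendsto_natCast_atTop_atTop.atTop_mul_const hy
    filter_upwards [this.eventually_ge_atTop 2] with n hn
    exact (Real.smoothTransition.one_of_one_le (by linarith)).symm
  let φn : ℕ → ℝ × ℝ → ℝ := fun n p => σ n p.2 * φ p
  have hηs : ∀ n, ContDiff ℝ ((⊤ : ℕ∞) : WithTop ℕ∞) fun p : ℝ × ℝ => σ n p.2 := fun n =>
    (hσs n).comp contDiff_snd
  have hφn : ∀ n, ContDiff ℝ ((⊤ : ℕ∞) : WithTop ℕ∞) (φn n) := fun n => (hηs n).mul hφ
  have hsub : ∀ n, tsupport (φn n) ⊆ tsupport φ := fun n => tsupport_mul_subset_right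
  have hcn : ∀ n, HasCompactSupport (φn n) := fun n => hc.mul_left
  have hpos : ∀ n, tsupport (φn n) ⊆ {p | 0 < p.2} := by
    intro n p hp
    have hcl : IsClosed {q : ℝ × ℝ | 1 ≤ (n : ℝ) * q.2} :=
      isClosed_le continuous_const (continuous_const.mul continuous_snd)
    have : p ∈ {q : ℝ × ℝ | 1 ≤ (n : ℝ) * q.2} := by
      refine closure_minimal (fun q hq => ?_) hcl hp
      by_contra hlt
      rw [Set.mem_ofPred_eq, not_le] at hlt
      exact hq (by simp [φn, σ, Real.smoothTransition.zero_of_nonpos (show (n : ℝ) * q.2 - 1 ≤ 0 by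
        linarith)])
    by_contra hlt
    have h1 : (n : ℝ) * p.2 ≤ 0 := mul_nonpos_of_nonneg_of_nonpos n.cast_nonneg (not_lt.1 hlt)
    have h2 : 1 ≤ (n : ℝ) * p.2 := this
    linarith
  have hsn : ∀ n, tsupport (φn n) ⊆ filmDomain h := by
    intro n p hp
    have h0 : 0 < p.2 := hpos n hp
    rcases hsupp ⟨hsub n hp, h0.le⟩ with h1 | h1
    · exact h1
    · exact absurd h1.1 h0.ne'
  have hder : ∀ n p, fderiv ℝ (φn n) p (1, 0) = σ n p.2 * fderiv ℝ φ p (1, 0) := by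
    intro n p
    have h1 : HasFDerivAt (fun p : ℝ × ℝ => σ n p.2)
        ((fderiv ℝ (σ n) p.2).comp (ContinuousLinearMap.snd ℝ ℝ ℝ)) p :=
      (((hσs n).differentiable (by simp)) p.2).hasFDerivAt.comp p hasFDerivAt_snd
    have h2 := h1.mul ((hφ.differentiable (by simp)) p).hasFDerivAt
    rw [show fderiv ℝ (φn n) p = _ from h2.fderiv]
    simp
  have hdc : Continuous fun p => fderiv ℝ φ p (1, 0) := (contDiff_fderiv_apply hφ _).continuous
  have hdcs : HasCompactSupport fun p => fderiv ℝ φ p (1, 0) :=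
    hc.mono' (subset_closure.trans (tsupport_fderiv_apply_subset φ _))
  have hlim : ∀ w ψ : ℝ × ℝ → ℝ, Integrable w (volume.restrict (filmDomain h)) → Continuous ψ →
      HasCompactSupport ψ → Tendsto (fun n => ∫ p in filmDomain h, w p * (σ n p.2 * ψ p)) atTop
        (𝓝 (∫ p in filmDomain h, w p * ψ p)) := by
    intro w ψ hw hψ hψc
    have hint := integrable_mul_of_hasCompactSupport hw hψ hψc
    refine tendsto_integral_of_dominated_convergence (fun p => ‖w p * ψ p‖) ?_ hint.norm ?_ ?_
    · intro n
      exact hw.1.mul ((hηs n).continuous.mul hψ).aestronglyMeasurable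
    · intro n
      refine Eventually.of_forall fun p => ?_
      rw [norm_mul, norm_mul, norm_mul]
      have := hσ1 n p.2
      have h3 : ‖σ n p.2‖ * ‖ψ p‖ ≤ ‖ψ p‖ := mul_le_of_le_one_left (norm_nonneg _) this
      exact mul_le_mul_of_nonneg_left h3 (norm_nonneg _)
    · refine (ae_restrict_iff' hΩ).2 (Eventually.of_forall fun p hp => ?_)
      simpa using ((hσlim p.2 hp.1).mul_const (ψ p)).const_mul (w p)
  refine tendsto_nhds_unique (hlim u _ hu hdc hdcs) ?_
  refine (hlim _ φ hg hφ.continuous hc).neg.congr fun n => ?_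
  have := (hs.isWeakGradient (φn n) (hφn n) (hcn n) (hsn n)).1
  simp only [hder] at this
  exact this.symm

/-- Testing the gradient of an admissible displacement with the divergence-free field of a stream
function: only the trace on the base matters. -/
theorem integral_gradient_mul_stream {V : ℝ} {h : ℝ → ℝ} {u : ℝ × ℝ → ℝ} {g : ℝ × ℝ → ℝ × ℝ}
    (ha : IsAdmissible V h u g) {ψ : ℝ × ℝ → ℝ} (hψ : ContDiff ℝ ((⊤ : ℕ∞) : WithTop ℕ∞) ψ)
    (hc : HasCompactSupport ψ)
    (hsupp : tsupport ψ ∩ {p | 0 ≤ p.2} ⊆ filmDomain h ∪ filmBase h) :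
    ∫ p in filmDomain h, ((g p).1 * fderiv ℝ ψ p (0, 1) - (g p).2 * fderiv ℝ ψ p (1, 0)) =
      -∫ x, ψ (x, 0) := by
  have hm : Measurable h := ha.lowerSemicontinuous.measurable
  have hi : Integrable h := ha.memBV.1
  have := isFiniteMeasure_restrict_filmDomain hm hi
  have hg : Integrable g (volume.restrict (filmDomain h)) :=
    ha.sobolev.memLp_gradient.integrable (by norm_num)
  have hds : ∀ v, ContDiff ℝ ((⊤ : ℕ∞) : WithTop ℕ∞) fun p => fderiv ℝ ψ p v :=
    contDiff_fderiv_apply hψ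
  have hdc : ∀ v, HasCompactSupport fun p => fderiv ℝ ψ p v := fun v =>
    hc.mono' (subset_closure.trans (tsupport_fderiv_apply_subset ψ v))
  have hdsupp : ∀ v, tsupport (fun p => fderiv ℝ ψ p v) ∩ {p | 0 ≤ p.2} ⊆
      filmDomain h ∪ filmBase h := fun v =>
    (Set.inter_subset_inter_left _ (tsupport_fderiv_apply_subset ψ v)).trans hsupp
  have hA := integral_mul_fderiv_horizontal hm hi ha.sobolev (hds (0, 1)) (hdc _) (hdsupp _)
  have hB := ha.trace _ (hds (1, 0)) (hdc _) (hdsupp _)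
  -- Equality of mixed derivatives cancels the two integrals containing u; only the trace term
  -- survives.
  have hsymm : ∀ p, fderiv ℝ (fun p => fderiv ℝ ψ p (1, 0)) p (0, 1) =
      fderiv ℝ (fun p => fderiv ℝ ψ p (0, 1)) p (1, 0) := by
    intro p
    have hd : DifferentiableAt ℝ (fderiv ℝ ψ) p :=
      ((hψ.fderiv_right (m := ((⊤ : ℕ∞) : WithTop ℕ∞)) (by simp)).differentiable (by simp)) p
    have h2 : ∀ v w, fderiv ℝ (fun p => fderiv ℝ ψ p v) p w = fderiv ℝ (fderiv ℝ ψ) p w v := by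
      intro v w
      rw [fderiv_clm_apply hd (differentiableAt_const v)]
      simp
    have h3 : minSmoothness ℝ 2 ≤ ((⊤ : ℕ∞) : WithTop ℕ∞) := by
      rw [minSmoothness_of_isRCLikeNormedField]
      exact WithTop.coe_le_coe.2 (le_top : (2 : ℕ∞) ≤ ⊤)
    rw [h2, h2]
    exact (hψ.contDiffAt.isSymmSndFDerivAt h3).eq _ _
  have hline : ∀ x, HasDerivAt (fun x : ℝ => ψ (x, 0)) (fderiv ℝ ψ (x, 0) (1, 0)) x := by
    intro x
    have h1 : HasDerivAt (fun x : ℝ => ((x, 0) : ℝ × ℝ)) (1, 0) x :=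
      (hasDerivAt_id x).prodMk (hasDerivAt_const x 0)
    exact ((hψ.differentiable (by simp)) (x, 0)).hasFDerivAt.comp_hasDerivAt x h1
  have hemb : Topology.IsClosedEmbedding fun x : ℝ => ((x, 0) : ℝ × ℝ) :=
    Topology.IsClosedEmbedding.of_continuous_injective_isClosedMap (by fun_prop)
      (fun a b hab => (Prod.mk.inj hab).1) (isClosedMap_prodMk_right (0 : ℝ))
  have hf : Continuous fun x : ℝ => ψ (x, 0) := hψ.continuous.comp (by fun_prop)
  have hfc : HasCompactSupport fun x : ℝ => ψ (x, 0) := hc.comp_isClosedEmbedding hemb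
  have hf' : Continuous fun x : ℝ => fderiv ℝ ψ (x, 0) (1, 0) :=
    (hds (1, 0)).continuous.comp (by fun_prop)
  have hfc' : HasCompactSupport fun x : ℝ => fderiv ℝ ψ (x, 0) (1, 0) :=
    (hdc (1, 0)).comp_isClosedEmbedding hemb
  -- On the base the tangential derivative of ψ vanishes where h is not positive, so the integral
  -- extends to the whole line, and integration by parts moves the derivative onto the trace x.
  have hD : ∫ x in {x | 0 < h x}, x * fderiv ℝ ψ (x, 0) (1, 0) = -∫ x, ψ (x, 0) := by
    rw [setIntegral_eq_integral_of_forall_compl_eq_zero]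
    · rw [integral_mul_deriv_eq_deriv_mul_of_integrable (u' := fun _ => 1)
        (v := fun x => ψ (x, 0)) (fun x _ => hasDerivAt_id' x) (fun x _ => hline x)]
      · simp
      · exact (continuous_id.mul hf').integrable_of_hasCompactSupport hfc'.mul_left
      · exact (continuous_const.mul hf).integrable_of_hasCompactSupport hfc.mul_left
      · exact (continuous_id.mul hf).integrable_of_hasCompactSupport hfc.mul_left
    · intro x hx
      by_contra hne
      have h1 : ((x, 0) : ℝ × ℝ) ∈ tsupport fun p => fderiv ℝ ψ p (1, 0) :=
        subset_closure fun h0 => hne (by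
          simp only at h0
          rw [h0, mul_zero])
      rcases hdsupp _ ⟨h1, le_refl (0 : ℝ)⟩ with h2 | h2
      · exact lt_irrefl _ h2.1
      · exact hx h2.2
  rw [integral_sub (integrable_mul_of_hasCompactSupport hg.fst (hds _).continuous (hdc _))
    (integrable_mul_of_hasCompactSupport hg.snd (hds _).continuous (hdc _))]
  simp only [hsymm] at hB
  linarith

/-! ### The lower bound by duality -/

/-- A smooth, monotone, `1`-Lipschitz approximation of the positive part that vanishes on
`(-∞, ε]`. -/
theorem exists_smooth_posPart {ε : ℝ} (hε : 0 < ε) : ∃ Φ : ℝ → ℝ,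
    ContDiff ℝ ((⊤ : ℕ∞) : WithTop ℕ∞) Φ ∧ (∀ t, t ≤ ε → Φ t = 0 ∧ deriv Φ t = 0) ∧
      (∀ t, 0 ≤ deriv Φ t ∧ deriv Φ t ≤ 1) ∧ ∀ t, |Φ t| ≤ |t| ∧ |Φ t - max t 0| ≤ 2 * ε := by
  let σ : ℝ → ℝ := fun s => Real.smoothTransition (s / ε - 1)
  have hσ : ContDiff ℝ ((⊤ : ℕ∞) : WithTop ℕ∞) σ :=
    Real.smoothTransition.contDiff.comp ((contDiff_id.div_const ε).sub contDiff_const)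
  have hσ0 : ∀ s, s ≤ ε → σ s = 0 := fun s hs =>
    Real.smoothTransition.zero_of_nonpos (by rw [sub_nonpos, div_le_one hε]; exact hs)
  have hσ1 : ∀ s, 2 * ε ≤ s → σ s = 1 := fun s hs =>
    Real.smoothTransition.one_of_one_le (by rw [le_sub_iff_add_le, le_div_iff₀ hε]; linarith)
  have hnn : ∀ s, 0 ≤ σ s := fun s => Real.smoothTransition.nonneg _
  have hle : ∀ s, σ s ≤ 1 := fun s => Real.smoothTransition.le_one _
  have hi : ∀ a b, IntervalIntegrable σ volume a b := fun a b =>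
    hσ.continuous.intervalIntegrable a b
  -- Φ is the primitive of a cutoff that rises from 0 to 1 between ε and 2ε, so it lags behind the
  -- positive part by at most 2ε.
  let Φ : ℝ → ℝ := fun t => ∫ s in (0 : ℝ)..t, σ s
  have hd : ∀ t, HasDerivAt Φ (σ t) t := fun t =>
    intervalIntegral.integral_hasDerivAt_right (hi _ _)
      (hσ.continuous.stronglyMeasurableAtFilter _ _) hσ.continuous.continuousAt
  have hderiv : deriv Φ = σ := funext fun t => (hd t).deriv
  have hΦ0 : ∀ t, t ≤ ε → Φ t = 0 := by
    intro t ht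
    have : ∀ s ∈ Set.uIcc 0 t, σ s = 0 := fun s hs => hσ0 s (by
      rcases Set.mem_uIcc.1 hs with h | h <;> linarith [h.1, h.2])
    simp only [Φ, intervalIntegral.integral_congr this, intervalIntegral.integral_zero]
  have hΦnn : ∀ t, 0 ≤ t → 0 ≤ Φ t := fun t ht =>
    intervalIntegral.integral_nonneg ht fun s _ => hnn s
  have hΦle : ∀ t, 0 ≤ t → Φ t ≤ t := by
    intro t ht
    have := intervalIntegral.integral_mono (μ := volume) ht (hi 0 t)
      (intervalIntegrable_const (c := (1 : ℝ))) fun s => hle s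
    simpa using this
  have hΦge : ∀ t, 2 * ε ≤ t → t - 2 * ε ≤ Φ t := by
    intro t ht
    have h1 : (∫ s in (2 * ε)..t, σ s) = t - 2 * ε := by
      rw [intervalIntegral.integral_congr (g := fun _ => (1 : ℝ))]
      · simp
      · intro s hs
        rw [Set.uIcc_of_le ht] at hs
        exact hσ1 s hs.1
    have h2 : Φ t = Φ (2 * ε) + ∫ s in (2 * ε)..t, σ s :=
      (intervalIntegral.integral_add_adjacent_intervals (hi _ _) (hi _ _)).symm
    linarith [hΦnn (2 * ε) (by linarith)]
  refine ⟨Φ, ?_, fun t ht => ⟨hΦ0 t ht, by rw [hderiv]; exact hσ0 t ht⟩,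
    fun t => by rw [hderiv]; exact ⟨hnn t, hle t⟩, fun t => ?_⟩
  · rw [contDiff_infty_iff_deriv, hderiv]
    exact ⟨fun t => (hd t).differentiableAt, hσ⟩
  · rcases le_total t 0 with h | h
    · rw [hΦ0 t (by linarith), max_eq_right h]
      simp [hε.le]
    · rw [max_eq_left h, abs_of_nonneg (hΦnn t h), abs_of_nonneg h, abs_le]
      refine ⟨hΦle t h, ?_, by linarith [hΦle t h]⟩
      rcases le_total (2 * ε) t with h2 | h2
      · linarith [hΦge t h2]
      · linarith [hΦnn t h]

/-- The stream function -Φ(k(x) - y) generates the field Φ'(k(x) - y) (1, k'(x)), a smoothing of (1,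
k') on the subgraph of k. Its pairing with the gradient is ∫ Φ(k), and Young's inequality separates
the two factors. -/
theorem two_mul_integral_comp_le {V : ℝ} {h : ℝ → ℝ} {u : ℝ × ℝ → ℝ} {g : ℝ × ℝ → ℝ × ℝ}
    (ha : IsAdmissible V h u g) (hv : BoundedVariationOn h Set.univ) {k : ℝ → ℝ}
    (hk : ContDiff ℝ ((⊤ : ℕ∞) : WithTop ℕ∞) k) (hkh : ∀ x, k x ≤ h x) {S : ℝ}
    (hS : ∀ x, |deriv k x| ≤ S) {ε : ℝ} (hε : 0 < ε) {Φ : ℝ → ℝ}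
    (hΦ : ContDiff ℝ ((⊤ : ℕ∞) : WithTop ℕ∞) Φ)
    (hΦ0 : ∀ t, t ≤ ε → Φ t = 0 ∧ deriv Φ t = 0) (hΦ1 : ∀ t, 0 ≤ deriv Φ t ∧ deriv Φ t ≤ 1) :
    2 * ∫ x, Φ (k x) ≤ (∫ p in filmDomain h, ((g p).1 ^ 2 + (g p).2 ^ 2)) +
      (1 + S ^ 2) * (volume (filmDomain k)).toReal := by
  have hm : Measurable h := ha.lowerSemicontinuous.measurable
  have hi : Integrable h := ha.memBV.1
  have hfin := isFiniteMeasure_restrict_filmDomain hm hi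
  have hΩ := measurableSet_filmDomain hm
  have hΩk := measurableSet_filmDomain hk.continuous.measurable
  obtain ⟨hlim1, hlim2⟩ := tendsto_zero_of_integrable_of_boundedVariationOn hi hv
  obtain ⟨b, hb⟩ := eventually_atTop.1 (hlim1.eventually_lt_const hε)
  obtain ⟨a, ha'⟩ := eventually_atBot.1 (hlim2.eventually_lt_const hε)
  set W := (eVariationOn h Set.univ).toReal
  have hW : ∀ x, h x ≤ W := fun x =>
    (le_abs_self _).trans (abs_le_eVariationOn_of_tendsto_zero hv hlim1 x)
  have hW0 : 0 ≤ W := ENNReal.toReal_nonneg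
  -- Where k(x) - y > ε and y ≥ 0, one has a < x < b and y ≤ W, so the ball of radius R (in the
  -- maximum norm) contains all that matters. The cutoff only removes the unbounded support in y <
  -- 0.
  let R : ℝ := |a| + |b| + W + 1
  have hR : 0 < R := by positivity
  let B : ContDiffBump (0 : ℝ × ℝ) := ⟨R, R + 1, hR, by linarith⟩
  let f : ℝ × ℝ → ℝ := fun p => Φ (k p.1 - p.2)
  have hf : ContDiff ℝ ((⊤ : ℕ∞) : WithTop ℕ∞) f :=
    hΦ.comp ((hk.comp contDiff_fst).sub contDiff_snd)
  let ψ : ℝ × ℝ → ℝ := fun p => B p * -f p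
  have hψ : ContDiff ℝ ((⊤ : ℕ∞) : WithTop ℕ∞) ψ := B.contDiff.mul hf.neg
  have hψc : HasCompactSupport ψ := B.hasCompactSupport.mul_right
  -- On the support k(x) - y ≥ ε, so it stays strictly below the graph of k, hence of h. This is why
  -- Φ must vanish up to ε and not merely up to 0.
  have hψsupp : tsupport ψ ∩ {p | 0 ≤ p.2} ⊆ filmDomain h ∪ filmBase h := by
    rintro p ⟨hp, hp2⟩
    have hcl : IsClosed {q : ℝ × ℝ | ε ≤ k q.1 - q.2} :=
      isClosed_le continuous_const ((hk.continuous.comp continuous_fst).sub continuous_snd)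
    have h1 : ε ≤ k p.1 - p.2 := by
      refine closure_minimal (fun q hq => ?_) hcl hp
      by_contra hlt
      have h2 : k q.1 - q.2 ≤ ε := (not_le.1 hlt).le
      exact hq (by simp [ψ, f, (hΦ0 _ h2).1])
    have h2 : (0 : ℝ) ≤ p.2 := hp2
    have h3 := hkh p.1
    rcases h2.eq_or_lt with h4 | h4
    · exact Or.inr ⟨h4.symm, by linarith⟩
    · exact Or.inl ⟨h4, by linarith⟩
  have hψeq : ∀ p : ℝ × ℝ, 0 ≤ p.2 → ψ p = -f p := by
    intro p hp
    rcases le_or_gt (k p.1 - p.2) ε with h1 | h1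
    · simp [ψ, f, (hΦ0 _ h1).1]
    · have hhp : ε < h p.1 := by linarith [hkh p.1]
      have hpa : a < p.1 := not_le.1 fun hle => (ha' _ hle).not_gt hhp
      have hpb : p.1 < b := not_le.1 fun hle => (hb _ hle).not_gt hhp
      have hpW : p.2 ≤ W := by linarith [hkh p.1, hW p.1]
      have hmem : p ∈ Metric.closedBall (0 : ℝ × ℝ) B.rIn := by
        rw [mem_closedBall_zero_iff, Prod.norm_def, Real.norm_eq_abs, Real.norm_eq_abs]
        refine max_le (abs_le.2 ?_) (abs_le.2 ?_)
        · have := neg_abs_le a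
          have := le_abs_self b
          have := abs_nonneg a
          have := abs_nonneg b
          constructor <;> simp only [B, R] <;> linarith
        · have := abs_nonneg a
          have := abs_nonneg b
          constructor <;> simp only [B, R] <;> linarith
      simp [ψ, B.one_of_mem_closedBall hmem]
  have hderiv : ∀ p ∈ filmDomain h, ∀ v : ℝ × ℝ, fderiv ℝ ψ p v =
      deriv Φ (k p.1 - p.2) * (v.2 - deriv k p.1 * v.1) := by
    intro p hp v
    have hev : ψ =ᶠ[𝓝 p] fun q => -f q := by
      filter_upwards [(isOpen_lt continuous_const continuous_snd).mem_nhds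
        (show (0 : ℝ) < p.2 from hp.1)] with q hq
      exact hψeq q (le_of_lt hq)
    have h1 : HasFDerivAt (fun q : ℝ × ℝ => k q.1 - q.2)
        (deriv k p.1 • ContinuousLinearMap.fst ℝ ℝ ℝ - ContinuousLinearMap.snd ℝ ℝ ℝ) p :=
      (((hk.differentiable (by simp)) p.1).hasDerivAt.comp_hasFDerivAt p hasFDerivAt_fst).sub
        hasFDerivAt_snd
    have h2 : HasFDerivAt f _ p :=
      ((hΦ.differentiable (by simp)) (k p.1 - p.2)).hasDerivAt.comp_hasFDerivAt p h1
    rw [hev.fderiv_eq, show fderiv ℝ (fun q => -f q) p = _ from h2.neg.fderiv]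
    simp
    ring
  have hstream := integral_gradient_mul_stream ha hψ hψc hψsupp
  have hbase : ∫ x, ψ (x, 0) = -∫ x, Φ (k x) := by
    rw [← integral_neg]
    refine integral_congr_ae (Eventually.of_forall fun x => ?_)
    simp [hψeq (x, 0) le_rfl, f]
  rw [hbase, neg_neg] at hstream
  have hg : Integrable g (volume.restrict (filmDomain h)) :=
    ha.sobolev.memLp_gradient.integrable (by norm_num)
  have hg1 : Integrable (fun p => (g p).1 ^ 2) (volume.restrict (filmDomain h)) :=
    ha.sobolev.memLp_gradient.fst.integrable_sq
  have hg2 : Integrable (fun p => (g p).2 ^ 2) (volume.restrict (filmDomain h)) :=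
    ha.sobolev.memLp_gradient.snd.integrable_sq
  have hg12 : Integrable (fun p => (g p).1 ^ 2 + (g p).2 ^ 2)
      (volume.restrict (filmDomain h)) := hg1.add hg2
  have hdc : ∀ v, HasCompactSupport fun p => fderiv ℝ ψ p v := fun v =>
    hψc.mono' (subset_closure.trans (tsupport_fderiv_apply_subset ψ v))
  have hind : Integrable ((filmDomain k).indicator fun _ => 1 + S ^ 2)
      (volume.restrict (filmDomain h)) :=
    (integrable_const _).indicator hΩk
  have hsub : filmDomain k ⊆ filmDomain h := fun p hp => ⟨hp.1, hp.2.trans_le (hkh _)⟩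
  have hindv : ∫ p in filmDomain h, (filmDomain k).indicator (fun _ => 1 + S ^ 2) p =
      (1 + S ^ 2) * (volume (filmDomain k)).toReal := by
    rw [setIntegral_indicator hΩk, Set.inter_eq_right.2 hsub, setIntegral_const, smul_eq_mul,
      mul_comm]
    rfl
  rw [← hstream, ← integral_const_mul, ← hindv, ← integral_add hg12 hind]
  refine setIntegral_mono_on
    (((integrable_mul_of_hasCompactSupport hg.fst (contDiff_fderiv_apply hψ _).continuous
      (hdc _)).sub (integrable_mul_of_hasCompactSupport hg.snd
      (contDiff_fderiv_apply hψ _).continuous (hdc _))).const_mul 2)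
    (hg12.add hind) hΩ fun p hp => ?_
  simp only [hderiv p hp]
  -- Inside the subgraph of k, the squares of g - d(1, s) and the bound d ≤ 1 give the claim;
  -- outside it the field vanishes.
  by_cases hpk : p ∈ filmDomain k
  · rw [Set.indicator_of_mem hpk]
    obtain ⟨hd0, hd1⟩ := hΦ1 (k p.1 - p.2)
    have hs2 : deriv k p.1 ^ 2 ≤ S ^ 2 := sq_le_sq' (abs_le.1 (hS p.1)).1 (abs_le.1 (hS p.1)).2
    set d := deriv Φ (k p.1 - p.2)
    set s := deriv k p.1
    have hdd : d ^ 2 ≤ 1 := pow_le_one₀ hd0 hd1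
    have h1 : d ^ 2 * (1 + s ^ 2) ≤ 1 * (1 + S ^ 2) :=
      mul_le_mul hdd (by linarith) (by positivity) zero_le_one
    have h2 := sq_nonneg ((g p).1 - d)
    have h3 := sq_nonneg ((g p).2 - d * s)
    linarith
  · rw [Set.indicator_of_notMem hpk]
    have h1 : k p.1 - p.2 ≤ ε := by
      by_contra hlt
      exact hpk ⟨hp.1, by linarith [not_le.1 hlt]⟩
    rw [(hΦ0 _ h1).2]
    have h2 := sq_nonneg (g p).1
    have h3 := sq_nonneg (g p).2
    linarith

/-- As ε → 0, ∫ Φ(k) tends to ∫ k⁺, which is also the area of the subgraph of k. One of the two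
copies of ∫ k⁺ on the left absorbs that area, and only S² ∫ k⁺ ≤ S² V is lost. -/
theorem integral_minorant_le_energy {V : ℝ} {h : ℝ → ℝ} {u : ℝ × ℝ → ℝ} {g : ℝ × ℝ → ℝ × ℝ}
    (ha : IsAdmissible V h u g) (hv : BoundedVariationOn h Set.univ) {k : ℝ → ℝ}
    (hk : ContDiff ℝ ((⊤ : ℕ∞) : WithTop ℕ∞) k) (hki : Integrable k) (hkh : ∀ x, k x ≤ h x)
    {S : ℝ} (hS : ∀ x, |deriv k x| ≤ S) :
    (∫ x, k x) - S ^ 2 * V ≤ ∫ p in filmDomain h, ((g p).1 ^ 2 + (g p).2 ^ 2) := by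
  have hpi : Integrable fun x => max (k x) 0 := hki.pos_part
  have hvol : (volume (filmDomain k)).toReal = ∫ x, max (k x) 0 := by
    rw [volume_filmDomain hk.continuous.measurable,
      integral_eq_lintegral_of_nonneg_ae (f := fun x => max (k x) 0)
        (Eventually.of_forall fun x => le_max_right _ _) hpi.1]
    congr 1
    refine lintegral_congr fun x => ?_
    rw [ENNReal.ofReal_max, ENNReal.ofReal_zero, max_eq_left zero_le]
  let ε : ℕ → ℝ := fun n => 1 / ((n : ℝ) + 1)
  have hε : ∀ n, 0 < ε n := fun n => by positivity
  choose Φ hΦ hΦ0 hΦ1 hΦ2 using fun n => exists_smooth_posPart (hε n)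
  have hlim : Tendsto (fun n => ∫ x, Φ n (k x)) atTop (𝓝 (∫ x, max (k x) 0)) := by
    refine tendsto_integral_of_dominated_convergence (fun x => |k x|)
      (fun n => ((hΦ n).continuous.comp hk.continuous).aestronglyMeasurable) hki.abs
      (fun n => Eventually.of_forall fun x => (hΦ2 n (k x)).1) (Eventually.of_forall fun x => ?_)
    rw [tendsto_iff_norm_sub_tendsto_zero]
    refine squeeze_zero (fun n => norm_nonneg _) (fun n => (hΦ2 n (k x)).2) ?_
    simpa [ε] using (tendsto_one_div_add_atTop_nhds_zero_nat (𝕜 := ℝ)).const_mul 2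
  have hmain := le_of_tendsto (hlim.const_mul 2) (Eventually.of_forall fun n =>
    two_mul_integral_comp_le ha hv hk hkh hS (hε n) (hΦ n) (hΦ0 n) (hΦ1 n))
  rw [hvol] at hmain
  have h1 : ∫ x, k x ≤ ∫ x, max (k x) 0 := integral_mono hki hpi fun x => le_max_left _ _
  have h2 : ∫ x, max (k x) 0 ≤ V := by
    rw [← ha.volume_eq]
    exact integral_mono hpi ha.memBV.1 fun x => max_le (hkh x) (ha.nonneg x)
  have h3 := mul_le_mul_of_nonneg_left h2 (sq_nonneg S)
  linarith

theorem elasticEnergy_eq_ofReal {V : ℝ} {h : ℝ → ℝ} {u : ℝ × ℝ → ℝ} {g : ℝ × ℝ → ℝ × ℝ}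
    (ha : IsAdmissible V h u g) : elasticEnergy h g =
      ENNReal.ofReal (∫ p in filmDomain h, ((g p).1 ^ 2 + (g p).2 ^ 2)) :=
  (ofReal_integral_eq_lintegral_ofReal (ha.sobolev.memLp_gradient.fst.integrable_sq.add
    ha.sobolev.memLp_gradient.snd.integrable_sq)
    (Eventually.of_forall fun _ => add_nonneg (sq_nonneg _) (sq_nonneg _))).symm

theorem exists_le_minEnergy : ∃ V₁ : ℝ, 0 < V₁ ∧ ∀ V : ℝ, 0 < V → V < V₁ →
    ENNReal.ofReal V ≤ minEnergy V := by
  obtain ⟨C, hC, hmin⟩ := exists_smooth_minorant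
  -- This threshold ensures CV ≤ 1/2; the 1 added to C covers C = 0.
  refine ⟨1 / (2 * (C + 1)), by positivity, fun V hV hV1 => ?_⟩
  simp only [minEnergy, le_iInf_iff]
  intro h u g ha
  rcases lt_or_ge (ENNReal.ofReal V) (surfaceEnergy h) with hlt | hle
  · exact hlt.le.trans le_add_self
  have hv : BoundedVariationOn h Set.univ := ne_top_of_le_ne_top ENNReal.ofReal_ne_top hle
  obtain ⟨k, hk, hkh, hki, hkint, hkS⟩ := hmin h ha.memBV.1 hv
  have hmain := integral_minorant_le_energy ha hv hk hki hkh hkS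
  have hW : surfaceEnergy h = ENNReal.ofReal (eVariationOn h Set.univ).toReal :=
    (ENNReal.ofReal_toReal hv).symm
  have hWV : (eVariationOn h Set.univ).toReal ≤ V := ENNReal.toReal_le_of_le_ofReal hV.le hle
  have hW0 : 0 ≤ (eVariationOn h Set.univ).toReal := ENNReal.toReal_nonneg
  rw [elasticEnergy_eq_ofReal ha, hW, ← ENNReal.ofReal_add
    (integral_nonneg fun p => add_nonneg (sq_nonneg _) (sq_nonneg _)) hW0]
  refine ENNReal.ofReal_le_ofReal ?_
  rw [ha.volume_eq] at hkint
  set W := (eVariationOn h Set.univ).toReal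
  have hCV : (C + 1) * V ≤ 1 / 2 := by
    rw [lt_div_iff₀ (by positivity)] at hV1
    linarith
  have hCV' : C * V ≤ 1 / 2 := by linarith
  have h1 : (C * W) * (C * V) ≤ (C * V) * (C * V) := by gcongr
  have h2 : (C * V) * (C * W) ≤ 1 / 2 * (1 / 2) := by
    have : C * W ≤ C * V := by gcongr
    exact mul_le_mul hCV' (this.trans hCV') (by positivity) (by norm_num)
  -- One factor W is kept aside: the slope loss becomes a small multiple of W, which the remaining
  -- half of the surface energy covers.
  have h3 : (C * W) ^ 2 * V = W * ((C * V) * (C * W)) := by ring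
  have h4 : W * ((C * V) * (C * W)) ≤ W * (1 / 2) := by
    apply mul_le_mul_of_nonneg_left _ hW0
    linarith
  linarith

/-! ### The upper bound by flat films -/

/-- The flat film of height `H` over the interval `(-l, l)`. -/
noncomputable def plateau (l H : ℝ) : ℝ → ℝ := (Set.Ioo (-l) l).indicator fun _ => H

theorem filmDomain_plateau (l H : ℝ) :
    filmDomain (plateau l H) = Set.Ioo (-l) l ×ˢ Set.Ioo 0 H := by
  ext ⟨x, y⟩
  by_cases hx : x ∈ Set.Ioo (-l) l
  · simp only [filmDomain, plateau, Set.mem_prod, hx, true_and]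
    simp [Set.indicator_of_mem hx]
  · simp only [filmDomain, plateau, Set.mem_prod, hx, false_and]
    simpa [Set.indicator_of_notMem hx] using fun h => h.le

theorem plateau_pos_iff {l H : ℝ} (hH : 0 < H) {x : ℝ} :
    0 < plateau l H x ↔ x ∈ Set.Ioo (-l) l := by
  by_cases hx : x ∈ Set.Ioo (-l) l
  · simp [plateau, hx, hH]
  · simp [plateau, hx]

theorem integrable_plateau (l H : ℝ) : Integrable (plateau l H) :=
  (integrable_indicator_iff measurableSet_Ioo).2 (by simp)

theorem integral_plateau {l : ℝ} (hl : 0 < l) (H : ℝ) : ∫ x, plateau l H x = 2 * l * H := by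
  rw [plateau, integral_indicator measurableSet_Ioo, setIntegral_const, smul_eq_mul,
    Real.volume_real_Ioo_of_le (by linarith)]
  ring

theorem memBV_plateau {l : ℝ} (hl : 0 < l) {H : ℝ} (hH : 0 < H) : MemBV (plateau l H) := by
  refine ⟨integrable_plateau l H, 2 * H, fun φ hφ _ hφ1 => ?_⟩
  have h1 : ∫ x, plateau l H x * deriv φ x = H * (φ l - φ (-l)) := by
    have h2 : (fun x => plateau l H x * deriv φ x) =
        (Set.Ioo (-l) l).indicator fun x => H * deriv φ x := by
      ext x
      by_cases hx : x ∈ Set.Ioo (-l) l <;> simp [plateau, hx]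
    rw [h2, integral_indicator measurableSet_Ioo, ← integral_Ioc_eq_integral_Ioo,
      ← intervalIntegral.integral_of_le (by linarith), intervalIntegral.integral_const_mul,
      intervalIntegral.integral_deriv_eq_sub
        (fun x _ => (hφ.differentiable (by simp)) x)
        ((hφ.continuous_deriv (by simp)).intervalIntegrable _ _)]
  rw [h1]
  have h3 := abs_le.1 (hφ1 l)
  have h4 := abs_le.1 (hφ1 (-l))
  nlinarith

/-- The profile is monotone on (-∞, 0], with variation at most H there; the other half follows by
reflection. -/
theorem surfaceEnergy_plateau_le {l : ℝ} (hl : 0 < l) {H : ℝ} (hH : 0 < H) :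
    surfaceEnergy (plateau l H) ≤ ENNReal.ofReal (2 * H) := by
  have hbd : ∀ x, 0 ≤ plateau l H x ∧ plateau l H x ≤ H := by
    intro x
    by_cases hx : x ∈ Set.Ioo (-l) l <;> simp [plateau, hx, hH.le]
  have hmono : MonotoneOn (plateau l H) (Set.Iic 0) := by
    intro a ha b hb hab
    by_cases hx : a ∈ Set.Ioo (-l) l
    · have hy : b ∈ Set.Ioo (-l) l := ⟨hx.1.trans_le hab, lt_of_le_of_lt hb hl⟩
      simp [plateau, hx, hy]
    · rw [show plateau l H a = 0 from Set.indicator_of_notMem hx _]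
      exact (hbd b).1
  have hleft : eVariationOn (plateau l H) (Set.Iic 0) ≤ ENNReal.ofReal H := by
    rw [eVariationOn.eq_biSup_inter_Icc]
    refine iSup₂_le fun p hp => ?_
    rw [hmono.eVariationOn_eq hp.1 hp.2.1]
    exact ENNReal.ofReal_le_ofReal (by linarith [(hbd p.1).1, (hbd p.2).2])
  have heven : plateau l H ∘ Neg.neg = plateau l H := by
    ext x
    have hiff : -x ∈ Set.Ioo (-l) l ↔ x ∈ Set.Ioo (-l) l := by
      constructor <;> rintro ⟨h1, h2⟩ <;> constructor <;> linarith
    by_cases hx : x ∈ Set.Ioo (-l) l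
    · simp only [plateau, Function.comp, Set.indicator_of_mem hx, Set.indicator_of_mem (hiff.2 hx)]
    · simp only [plateau, Function.comp, Set.indicator_of_notMem hx,
        Set.indicator_of_notMem (fun h => hx (hiff.1 h))]
  have hright : eVariationOn (plateau l H) (Set.Ici 0) ≤ eVariationOn (plateau l H) (Set.Iic 0) := by
    conv_lhs => rw [← heven]
    exact eVariationOn.comp_le_of_antitoneOn _ Neg.neg (fun _ _ _ _ hab => neg_le_neg hab)
      fun _ hx => Set.mem_Iic.2 (neg_nonpos.2 (Set.mem_Ici.1 hx))
  rw [surfaceEnergy, ← Set.Iic_union_Ici (a := (0 : ℝ)),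
    eVariationOn.union _ isGreatest_Iic isLeast_Ici, two_mul,
    ENNReal.ofReal_add hH.le hH.le]
  exact add_le_add hleft (hright.trans hleft)

theorem isSobolevWithGradient_fst (l H : ℝ) :
    IsSobolevWithGradient (filmDomain (plateau l H)) Prod.fst fun _ => (1, 0) := by
  have hfin : IsFiniteMeasure (volume.restrict (filmDomain (plateau l H))) := by
    rw [filmDomain_plateau]
    refine ⟨?_⟩
    rw [Measure.restrict_apply_univ, Measure.volume_eq_prod, Measure.prod_prod]
    exact ENNReal.mul_lt_top (by simp) (by simp)
  refine ⟨?_, memLp_const _, fun φ hφ hc hs => ?_⟩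
  · refine MemLp.of_bound measurable_fst.aestronglyMeasurable l ?_
    rw [filmDomain_plateau]
    refine (ae_restrict_iff' (measurableSet_Ioo.prod measurableSet_Ioo)).2
      (Eventually.of_forall fun p hp => ?_)
    exact abs_le.2 ⟨hp.1.1.le, hp.1.2.le⟩
  · have hφ0 : ∀ p, p ∉ filmDomain (plateau l H) → φ p = 0 := fun p hp =>
      image_eq_zero_of_notMem_tsupport fun h => hp (hs h)
    have hd0 : ∀ v, ∀ p, p ∉ filmDomain (plateau l H) → fderiv ℝ φ p v = 0 := by
      intro v p hp
      have : fderiv ℝ φ p = 0 :=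
        image_eq_zero_of_notMem_tsupport fun h => hp (hs (tsupport_fderiv_subset ℝ h))
      rw [this]
      rfl
    have hdc : Continuous (fderiv ℝ φ) := hφ.continuous_fderiv (by simp)
    have hv : ∀ v : ℝ × ℝ, ∫ p : ℝ × ℝ, p.1 * fderiv ℝ φ p v = -∫ p, v.1 * φ p := by
      intro v
      have hcv : Continuous fun p => fderiv ℝ φ p v := hdc.clm_apply continuous_const
      have hccv : HasCompactSupport fun p => fderiv ℝ φ p v := hc.fderiv_apply ℝ v
      have hfst : ∀ p : ℝ × ℝ, fderiv ℝ (fun q : ℝ × ℝ => q.1) p v = v.1 := fun p => by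
        rw [show fderiv ℝ (fun q : ℝ × ℝ => q.1) p = _ from fderiv_fst]
        rfl
      rw [integral_mul_fderiv_eq_neg_fderiv_mul_of_integrable (f := fun p : ℝ × ℝ => p.1)]
      · simp only [hfst]
      · simp only [hfst]
        exact (continuous_const.mul hφ.continuous).integrable_of_hasCompactSupport hc.mul_left
      · exact (continuous_fst.mul hcv).integrable_of_hasCompactSupport hccv.mul_left
      · exact (continuous_fst.mul hφ.continuous).integrable_of_hasCompactSupport hc.mul_left
      · exact fun p _ => differentiableAt_fst
      · exact fun p _ => (hφ.differentiable (by simp)) p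
    have hset : ∀ v : ℝ × ℝ, ∫ p in filmDomain (plateau l H), p.1 * fderiv ℝ φ p v =
        -∫ p in filmDomain (plateau l H), v.1 * φ p := by
      intro v
      -- The test function is supported in the film, so the integration by parts can be done in the
      -- whole plane.
      rw [setIntegral_eq_integral_of_forall_compl_eq_zero fun p hp => by rw [hd0 v p hp, mul_zero],
        setIntegral_eq_integral_of_forall_compl_eq_zero fun p hp => by rw [hφ0 p hp, mul_zero]]
      exact hv v
    exact ⟨hset (1, 0), hset (0, 1)⟩

/-- By Fubini and the fundamental theorem of calculus on vertical segments, only the endpoint y = 0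
contributes: the top y = H lies outside the support of the test function. -/
theorem hasBaseTrace_fst {l H : ℝ} (hH : 0 < H) :
    HasBaseTrace (plateau l H) Prod.fst (fun _ => (1, 0)) fun x => x := by
  intro φ hφ hc hs
  have hbase : {x | 0 < plateau l H x} = Set.Ioo (-l) l := by
    ext x
    exact plateau_pos_iff hH
  have hcv : Continuous fun p : ℝ × ℝ => p.1 * fderiv ℝ φ p (0, 1) :=
    continuous_fst.mul ((hφ.continuous_fderiv (by simp)).clm_apply continuous_const)
  have hint : Integrable fun p : ℝ × ℝ => p.1 * fderiv ℝ φ p (0, 1) :=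
    hcv.integrable_of_hasCompactSupport (hc.fderiv_apply ℝ _).mul_left
  have htop : ∀ x, φ (x, H) = 0 := by
    intro x
    refine image_eq_zero_of_notMem_tsupport fun h => ?_
    rcases hs ⟨h, hH.le⟩ with h1 | h1
    · rw [filmDomain_plateau] at h1
      exact lt_irrefl _ h1.2.2
    · exact hH.ne' h1.1
  have hvert : ∀ x, ∫ y in Set.Ioo 0 H, x * fderiv ℝ φ (x, y) (0, 1) = -(x * φ (x, 0)) := by
    intro x
    have hder : ∀ y, HasDerivAt (fun y : ℝ => φ (x, y)) (fderiv ℝ φ (x, y) (0, 1)) y := by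
      intro y
      have h1 : HasDerivAt (fun y : ℝ => ((x, y) : ℝ × ℝ)) (0, 1) y :=
        (hasDerivAt_const y x).prodMk (hasDerivAt_id y)
      exact ((hφ.differentiable (by simp)) (x, y)).hasFDerivAt.comp_hasDerivAt y h1
    rw [← integral_Ioc_eq_integral_Ioo, ← intervalIntegral.integral_of_le hH.le,
      intervalIntegral.integral_const_mul, intervalIntegral.integral_eq_sub_of_hasDerivAt
        (fun y _ => hder y), htop]
    · ring
    · have hcd : Continuous fun y : ℝ => fderiv ℝ φ (x, y) (0, 1) :=
        ((hφ.continuous_fderiv (by simp)).comp (by fun_prop)).clm_apply continuous_const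
      exact hcd.intervalIntegrable _ _
  rw [hbase, filmDomain_plateau, Measure.volume_eq_prod, setIntegral_prod _ hint.integrableOn]
  simp only [hvert, zero_mul, integral_zero, add_zero, integral_neg]

theorem isAdmissible_plateau {l : ℝ} (hl : 0 < l) {H : ℝ} (hH : 0 < H) :
    IsAdmissible (2 * l * H) (plateau l H) Prod.fst fun _ => (1, 0) where
  memBV := memBV_plateau hl hH
  lowerSemicontinuous := isOpen_Ioo.lowerSemicontinuous_indicator hH.le
  nonneg x := Set.indicator_nonneg (fun _ _ => hH.le) x
  volume_eq := integral_plateau hl H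
  sobolev := isSobolevWithGradient_fst _ _
  trace := hasBaseTrace_fst hH

theorem elasticEnergy_plateau {l : ℝ} (hl : 0 < l) (H : ℝ) :
    elasticEnergy (plateau l H) (fun _ => (1, 0)) = ENNReal.ofReal (2 * l * H) := by
  rw [elasticEnergy, setLIntegral_const, filmDomain_plateau, Measure.volume_eq_prod,
    Measure.prod_prod, Real.volume_Ioo, Real.volume_Ioo, ← ENNReal.ofReal_mul (by linarith),
    ← ENNReal.ofReal_mul (by norm_num)]
  congr 1
  ring

theorem minEnergy_le {V : ℝ} (hV : 0 < V) : minEnergy V ≤ ENNReal.ofReal V := by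
  have hle : ∀ H : ℝ, 0 < H → minEnergy V ≤ ENNReal.ofReal (V + 2 * H) := by
    intro H hH
    -- The half-length is dictated by the volume 2lH = V, so a thinner film is longer.
    have hl : 0 < V / (2 * H) := by positivity
    have hVl : 2 * (V / (2 * H)) * H = V := by field_simp
    have ha := isAdmissible_plateau hl hH
    have hE := elasticEnergy_plateau hl H
    rw [hVl] at ha hE
    have h1 : minEnergy V ≤ elasticEnergy (plateau (V / (2 * H)) H) (fun _ => (1, 0)) +
        surfaceEnergy (plateau (V / (2 * H)) H) :=
      iInf_le_of_le _ (iInf_le_of_le _ (iInf_le_of_le _ (iInf_le _ ha)))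
    refine h1.trans ?_
    rw [hE, ENNReal.ofReal_add hV.le (by positivity)]
    exact add_le_add_right (surfaceEnergy_plateau_le hl hH) _
  have hlim : Tendsto (fun H : ℝ => ENNReal.ofReal (V + 2 * H)) (𝓝[>] 0)
      (𝓝 (ENNReal.ofReal V)) := by
    have : Continuous fun H : ℝ => ENNReal.ofReal (V + 2 * H) :=
      ENNReal.continuous_ofReal.comp (by fun_prop)
    simpa using (this.tendsto 0).mono_left nhdsWithin_le_nhds
  exact ge_of_tendsto hlim (eventually_nhdsWithin_of_forall hle)

/-! ### The exact value for small volumes -/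

theorem exists_minEnergy_eq : ∃ V₁ : ℝ, 0 < V₁ ∧ ∀ V : ℝ, 0 < V → V < V₁ →
    minEnergy V = ENNReal.ofReal V := by
  obtain ⟨V₁, hV₁, hle⟩ := exists_le_minEnergy
  exact ⟨V₁, hV₁, fun V hV hV1 => (minEnergy_le hV).antisymm (hle V hV hV1)⟩

end EpitaxialFilm

theorem mainTheorem9 :
    (∀ δ : ℝ, 0 < δ → ∃ V₁ : ℝ, 0 < V₁ ∧ ∀ V : ℝ, 0 < V → V < V₁ →
      ENNReal.ofReal ((1 - δ) * V) ≤ EpitaxialFilm.minEnergy V ∧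
        EpitaxialFilm.minEnergy V ≤ ENNReal.ofReal V) ∧
    Tendsto (fun V : ℝ => EpitaxialFilm.minEnergy V / ENNReal.ofReal V) (𝓝[>] 0) (𝓝 1) := by
  obtain ⟨V₁, hV₁, heq⟩ := EpitaxialFilm.exists_minEnergy_eq
  refine ⟨fun δ hδ => ⟨V₁, hV₁, fun V hV hV1 => ?_⟩, ?_⟩
  · rw [heq V hV hV1]
    exact ⟨ENNReal.ofReal_le_ofReal (by nlinarith), le_rfl⟩
  · refine tendsto_const_nhds.congr' ?_
    filter_upwards [Ioo_mem_nhdsGT hV₁] with V hV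
    rw [heq V hV.1 hV.2, ENNReal.div_self (ENNReal.ofReal_pos.2 hV.1).ne' ENNReal.ofReal_ne_top]
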